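/- Let $\alpha>-1$ and let $\gamma=\{\gamma_{p,\alpha}\}_{p\ge 0}$ be the sequence of Dunkl factorials, $$\gamma_{2k,\alpha}=2^{2k}\,k!\,(\alpha+1)_k,\qquad \gamma_{2k+1,\alpha}=2^{2k+1}\,k!\,(\alpha+1)_{k+1}\qquad(k\ge 0),$$ where $(a)_k=a(a+1)\cdots(a+k-1)$ is the Pochhammer symbol. Let $M$ be the associated function of $\gamma$, that is, $M(0)=0$ and $$M(t)=\sup_{p\ge 0}\log\frac{t^p}{\gamma_{p,\alpha}}\qquad(t>0),$$ and put $d(t)=\log M(t)/\log t$. A function $\rho$ on an interval $(c,\infty)$ is called a nonzero proximate order if - $\rho$ is continuous and piecewise continuously differentiable on $(c,\infty)$: there is an exceptional set $S$ having only finitely many points in $(c,b]$ for each $b$, such that $\rho$ is continuously differentiable on $(c,\infty)\setminus S$ and $\rho'$ has finite one-sided limits at the points of $S\cap(c,\infty)$; - $\rho(r)\ge 0$ for all $r>c$; - $\lim_{r\to\infty}\rho(r)$ exists and is a positive real number; - $\lim_{r\to\infty} r\,\rho'(r)\log r=0$, where $r$ runs through the points outside $S$. Then the supremum defining $M(t)$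 is finite for every $t>0$, and there is $c\ge 1$ such that $M(t)>0$ for all $t>c$ (so that $d$ is well defined on $(c,\infty)$) and $d$ is a nonzero proximate order on $(c,\infty)$. -/

import Mathlib

open Filter Topology

noncomputable section

/-- The Dunkl factorials: `γ_{2k} = 2^{2k} k! (α+1)_k` and
`γ_{2k+1} = 2^{2k+1} k! (α+1)_{k+1}`, where `(a)_k` is the Pochhammer symbol
(rising factorial) `a (a+1) ⋯ (a+k-1)`. Here `k = p / 2` is integer division. -/
def dunklFactorial (α : ℝ) (p : ℕ) : ℝ :=
  if Even p then
    2 ^ p * (Nat.factorial (p / 2) : ℝ) * (ascPochhammer ℝ (p / 2)).eval (α + 1)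
  else
    2 ^ p * (Nat.factorial (p / 2) : ℝ) * (ascPochhammer ℝ (p / 2 + 1)).eval (α + 1)

/-- The associated function of a sequence `m` of positive numbers: `M(0) = 0` and
`M(t) = sup_{p ≥ 0} log (t ^ p / m p)` for `t > 0` (values at `t < 0` are irrelevant). -/
def associatedFunction (m : ℕ → ℝ) (t : ℝ) : ℝ :=
  if t ≤ 0 then 0 else ⨆ p : ℕ, Real.log (t ^ p / m p)

/-- `d(t) = log M(t) / log t`, with `M` the associated function of `m`. -/
def proximateOrderCandidate (m : ℕ → ℝ) (t : ℝ) : ℝ :=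
  Real.log (associatedFunction m t) / Real.log t

/-- `ρ` is a nonzero proximate order on the interval `(c, ∞)`: it is continuous, nonnegative
and piecewise continuously differentiable there (`S` is the set of exceptional points, which
is finite in each `(c, b]`; off `S` the derivative exists and is continuous, and it has finite
one-sided limits at the points of `S`), `ρ(r)` has a finite limit, which is positive, and
`r ρ'(r) log r → 0` as `r → ∞`, where `r` ranges over the points at which `ρ'` is required
to exist. -/
def IsNonzeroProximateOrder (c : ℝ) (ρ : ℝ → ℝ) : Prop :=
  ContinuousOn ρ (Set.Ioi c) ∧
  (∀ r, c < r → 0 ≤ ρ r) ∧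
  (∃ l : ℝ, 0 < l ∧ Tendsto ρ atTop (𝓝 l)) ∧
  ∃ S : Set ℝ,
    (∀ b : ℝ, (S ∩ Set.Ioc c b).Finite) ∧
    (∀ r ∈ Set.Ioi c \ S, DifferentiableAt ℝ ρ r) ∧
    ContinuousOn (deriv ρ) (Set.Ioi c \ S) ∧
    (∀ s ∈ S ∩ Set.Ioi c,
      (∃ a : ℝ, Tendsto (deriv ρ) (𝓝[<] s) (𝓝 a)) ∧
      (∃ b : ℝ, Tendsto (deriv ρ) (𝓝[>] s) (𝓝 b))) ∧
    Tendsto (fun r => r * deriv ρ r * Real.log r) (atTop ⊓ 𝓟 Sᶜ) (𝓝 0)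

end

/-! The only arithmetic input is that consecutive Dunkl factorials have quotient `p + 1 + O(1)`. If
`p` attains the supremum at `t`, comparison with `p - 1` and `p + 1` gives `p = t + O(1)`
(`IsMaxIndex.abs_sub_le`). Between ties `M` is a single function `p log t - log (m p)`, so its right
derivative is `p / t = 1 + O(1/t)`; integration gives `M(t) = t + O(log t)`, whence `M(t)/t → 1` and
`d → 1`. Off the ties, `t d'(t) log t = p / M(t) - d(t) → 1 - 1 = 0`.

The quotients need not be monotone in `p`, so log-convexity is unavailable and several indices may
tie at once. Ties are locally finite, and the largest (smallest) tied index stays maximal just to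
the right (left), which gives the piecewise regularity. -/

/-- The function `t ↦ log (t ^ p / m p)`, whose supremum over `p` is the associated function. -/
noncomputable def logTerm (m : ℕ → ℝ) (p : ℕ) (t : ℝ) : ℝ := Real.log (t ^ p / m p)

/-- The index `p` attains the supremum defining the associated function at `t`. -/
def IsMaxIndex (m : ℕ → ℝ) (t : ℝ) (p : ℕ) : Prop := ∀ q, logTerm m q t ≤ logTerm m p t

/-- The points at which several indices attain the supremum. -/
def jumpSet (m : ℕ → ℝ) : Set ℝ :=
  {t | 0 < t ∧ ∃ p q, p ≠ q ∧ IsMaxIndex m t p ∧ IsMaxIndex m t q}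

/-! ### Maximal indices and the local structure of `M` -/

section General

variable {m : ℕ → ℝ}

lemma logTerm_eq (hm : ∀ p, 0 < m p) {t : ℝ} (ht : 0 < t) (p : ℕ) :
    logTerm m p t = p * Real.log t - Real.log (m p) := by
  rw [logTerm, Real.log_div (pow_pos ht p).ne' (hm p).ne', Real.log_pow]

lemma hasDerivAt_logTerm (hm : ∀ p, 0 < m p) {t : ℝ} (ht : 0 < t) (p : ℕ) :
    HasDerivAt (logTerm m p) (p / t) t := by
  have h : HasDerivAt (fun t : ℝ => (p : ℝ) * Real.log t - Real.log (m p)) (p / t) t := by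
    simpa [div_eq_mul_inv] using
      ((Real.hasDerivAt_log ht.ne').const_mul (p : ℝ)).sub_const (Real.log (m p))
  refine h.congr_of_eventuallyEq ?_
  filter_upwards [lt_mem_nhds ht] with x hx using logTerm_eq hm hx p

lemma logTerm_succ_le_iff (hm : ∀ p, 0 < m p) {t : ℝ} (ht : 0 < t) (p : ℕ) :
    logTerm m (p + 1) t ≤ logTerm m p t ↔ t ≤ m (p + 1) / m p := by
  rw [logTerm, logTerm, Real.log_le_log_iff (div_pos (pow_pos ht _) (hm _))
    (div_pos (pow_pos ht _) (hm _)), div_le_div_iff₀ (hm _) (hm _), le_div_iff₀ (hm _), pow_succ,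
    mul_assoc]
  exact mul_le_mul_iff_right₀ (pow_pos ht p)

lemma logTerm_succ_lt_iff (hm : ∀ p, 0 < m p) {t : ℝ} (ht : 0 < t) (p : ℕ) :
    logTerm m (p + 1) t < logTerm m p t ↔ t < m (p + 1) / m p := by
  rw [logTerm, logTerm, Real.log_lt_log_iff (div_pos (pow_pos ht _) (hm _))
    (div_pos (pow_pos ht _) (hm _)), div_lt_div_iff₀ (hm _) (hm _), lt_div_iff₀ (hm _), pow_succ,
    mul_assoc]
  exact mul_lt_mul_iff_right₀ (pow_pos ht p)

/-- Once the quotients exceed `b`, the terms strictly decrease in `p`. The same `N` serves all of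
`(0, b]`, so only finitely many indices compete there. -/
lemma exists_forall_logTerm_lt (hm : ∀ p, 0 < m p)
    (hq : Tendsto (fun p => m (p + 1) / m p) atTop atTop) (b : ℝ) :
    ∃ N, ∀ t, 0 < t → t ≤ b → ∀ q, N < q → logTerm m q t < logTerm m N t := by
  obtain ⟨N, hN⟩ := eventually_atTop.1 (hq.eventually_gt_atTop b)
  refine ⟨N, fun t ht htb q hNq => ?_⟩
  induction q, hNq using Nat.le_induction with
  | base => exact (logTerm_succ_lt_iff hm ht N).2 (htb.trans_lt (hN N le_rfl))
  | succ q hq ih =>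
    exact ((logTerm_succ_lt_iff hm ht q).2
      (htb.trans_lt (hN q ((Nat.le_succ N).trans hq)))).trans ih

lemma exists_isMaxIndex (hm : ∀ p, 0 < m p)
    (hq : Tendsto (fun p => m (p + 1) / m p) atTop atTop) {t : ℝ} (ht : 0 < t) :
    ∃ p, IsMaxIndex m t p := by
  obtain ⟨N, hN⟩ := exists_forall_logTerm_lt hm hq t
  obtain ⟨p, -, hp⟩ := (Finset.range (N + 1)).exists_max_image (fun p => logTerm m p t)
    ⟨N, by simp⟩
  refine ⟨p, fun q => ?_⟩
  rcases le_or_gt q N with h | h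
  · exact hp q (by simpa [Nat.lt_succ_iff] using h)
  · exact (hN t ht le_rfl q h).le.trans (hp N (by simp))

lemma IsMaxIndex.bddAbove {t : ℝ} {p : ℕ} (h : IsMaxIndex m t p) :
    BddAbove (Set.range fun p : ℕ => Real.log (t ^ p / m p)) :=
  ⟨logTerm m p t, by rintro _ ⟨q, rfl⟩; exact h q⟩

lemma IsMaxIndex.associatedFunction_eq {t : ℝ} (ht : 0 < t) {p : ℕ} (h : IsMaxIndex m t p) :
    associatedFunction m t = logTerm m p t := by
  rw [associatedFunction, if_neg ht.not_ge]
  exact le_antisymm (ciSup_le h) (le_ciSup h.bddAbove p)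

/-- Indices not maximal at `s` stay below `P` nearby by continuity, and only finitely many matter,
so `h` need only treat ties. The filter `l` covers one-sided and full neighbourhoods. -/
lemma eventually_isMaxIndex (hm : ∀ p, 0 < m p)
    (hq : Tendsto (fun p => m (p + 1) / m p) atTop atTop) {s : ℝ} (hs : 0 < s) {P : ℕ}
    (hP : IsMaxIndex m s P) {l : Filter ℝ} (hl : l ≤ 𝓝 s)
    (h : ∀ q, IsMaxIndex m s q → ∀ᶠ t in l, logTerm m q t ≤ logTerm m P t) :
    ∀ᶠ t in l, IsMaxIndex m t P := by
  obtain ⟨N, hN⟩ := exists_forall_logTerm_lt hm hq (s + 1)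
  have key : ∀ q ∈ Finset.range (N + 1), ∀ᶠ t in l, logTerm m q t ≤ logTerm m P t := by
    intro q _
    by_cases hqs : IsMaxIndex m s q
    · exact h q hqs
    · have hlt : logTerm m q s < logTerm m P s := by
        by_contra hcon
        exact hqs fun r => (hP r).trans (not_lt.1 hcon)
      have := ((hasDerivAt_logTerm hm hs q).continuousAt.eventually_lt
        (hasDerivAt_logTerm hm hs P).continuousAt hlt)
      exact (this.filter_mono hl).mono fun t ht => ht.le
  filter_upwards [(eventually_all_finset _).2 key, hl (lt_mem_nhds hs),
    hl (gt_mem_nhds (lt_add_one s))] with t h1 h2 h3 q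
  rcases le_or_gt q N with hqN | hqN
  · exact h1 q (by simpa [Nat.lt_succ_iff] using hqN)
  · exact (hN t h2 (le_of_lt h3) q hqN).le.trans (h1 N (by simp))

lemma IsMaxIndex.logTerm_sub_eq (hm : ∀ p, 0 < m p) {s t : ℝ} (hs : 0 < s) (ht : 0 < t)
    {p q : ℕ} (hp : IsMaxIndex m s p) (hq : IsMaxIndex m s q) :
    logTerm m p t - logTerm m q t = ((p : ℝ) - q) * (Real.log t - Real.log s) := by
  have h := le_antisymm (hp q) (hq p)
  rw [logTerm_eq hm hs, logTerm_eq hm hs] at h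
  rw [logTerm_eq hm ht, logTerm_eq hm ht]
  linarith

lemma bddAbove_isMaxIndex (hm : ∀ p, 0 < m p)
    (hq : Tendsto (fun p => m (p + 1) / m p) atTop atTop) (b : ℝ) :
    ∃ N, ∀ t, 0 < t → t ≤ b → ∀ p, IsMaxIndex m t p → p ≤ N := by
  obtain ⟨N, hN⟩ := exists_forall_logTerm_lt hm hq b
  exact ⟨N, fun t ht htb p hp => not_lt.1 fun hlt => (hN t ht htb p hlt).not_ge (hp N)⟩

/-- The difference of two tied terms is a multiple of `log t - log s` by the index difference, so to
the right of `s` the largest tied index wins. -/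
lemma exists_eventually_isMaxIndex_right (hm : ∀ p, 0 < m p)
    (hq : Tendsto (fun p => m (p + 1) / m p) atTop atTop) {s : ℝ} (hs : 0 < s) :
    ∃ P, IsMaxIndex m s P ∧ ∀ᶠ t in 𝓝[>] s, IsMaxIndex m t P := by
  obtain ⟨N, hN⟩ := bddAbove_isMaxIndex hm hq s
  have hbdd : BddAbove {p | IsMaxIndex m s p} := ⟨N, fun p hp => hN s hs le_rfl p hp⟩
  have hP : IsMaxIndex m s (sSup {p | IsMaxIndex m s p}) :=
    Nat.sSup_mem (exists_isMaxIndex hm hq hs) hbdd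
  refine ⟨_, hP, eventually_isMaxIndex hm hq hs hP nhdsWithin_le_nhds fun q hqs => ?_⟩
  filter_upwards [self_mem_nhdsWithin] with t ht
  have hle : (q : ℝ) ≤ (sSup {p | IsMaxIndex m s p} : ℕ) := by exact_mod_cast le_csSup hbdd hqs
  have h1 := hP.logTerm_sub_eq hm hs (hs.trans ht) hqs
  have h2 := mul_nonneg (sub_nonneg.2 hle) (sub_nonneg.2 (Real.log_le_log hs (le_of_lt ht)))
  linarith

lemma exists_eventually_isMaxIndex_left (hm : ∀ p, 0 < m p)
    (hq : Tendsto (fun p => m (p + 1) / m p) atTop atTop) {s : ℝ} (hs : 0 < s) :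
    ∃ P, IsMaxIndex m s P ∧ ∀ᶠ t in 𝓝[<] s, IsMaxIndex m t P := by
  have hP : IsMaxIndex m s (sInf {p | IsMaxIndex m s p}) :=
    Nat.sInf_mem (exists_isMaxIndex hm hq hs)
  refine ⟨_, hP, eventually_isMaxIndex hm hq hs hP nhdsWithin_le_nhds fun q hqs => ?_⟩
  filter_upwards [self_mem_nhdsWithin, nhdsWithin_le_nhds (lt_mem_nhds hs)] with t ht ht0
  have hle : ((sInf {p | IsMaxIndex m s p} : ℕ) : ℝ) ≤ q := by exact_mod_cast Nat.sInf_le hqs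
  have h1 := hqs.logTerm_sub_eq hm hs ht0 hP
  have h2 := mul_nonneg (sub_nonneg.2 hle) (sub_nonneg.2 (Real.log_le_log ht0 (le_of_lt ht)))
  linarith

lemma eventually_isMaxIndex_of_notMem_jumpSet (hm : ∀ p, 0 < m p)
    (hq : Tendsto (fun p => m (p + 1) / m p) atTop atTop) {s : ℝ} (hs : 0 < s)
    (hsS : s ∉ jumpSet m) {P : ℕ} (hP : IsMaxIndex m s P) : ∀ᶠ t in 𝓝 s, IsMaxIndex m t P := by
  refine eventually_isMaxIndex hm hq hs hP le_rfl fun q hqs => ?_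
  have : q = P := by
    by_contra hne
    exact hsS ⟨hs, q, P, hne, hqs, hP⟩
  simp [this]

lemma continuousAt_associatedFunction (hm : ∀ p, 0 < m p)
    (hq : Tendsto (fun p => m (p + 1) / m p) atTop atTop) {s : ℝ} (hs : 0 < s) :
    ContinuousAt (associatedFunction m) s := by
  have key : ∀ {A : Set ℝ} {P : ℕ}, IsMaxIndex m s P → (∀ᶠ t in 𝓝[A] s, IsMaxIndex m t P) →
      ContinuousWithinAt (associatedFunction m) A s := fun hP hev =>
    (hasDerivAt_logTerm hm hs _).continuousAt.continuousWithinAt.congr_of_eventuallyEq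
      (by
        filter_upwards [hev, nhdsWithin_le_nhds (lt_mem_nhds hs)] with t ht ht0
        exact ht.associatedFunction_eq ht0)
      (hP.associatedFunction_eq hs)
  obtain ⟨P, hP, hPe⟩ := exists_eventually_isMaxIndex_right hm hq hs
  obtain ⟨Q, hQ, hQe⟩ := exists_eventually_isMaxIndex_left hm hq hs
  exact continuousAt_iff_continuous_left'_right'.2 ⟨key hQ hQe, key hP hPe⟩

lemma hasDerivWithinAt_associatedFunction (hm : ∀ p, 0 < m p)
    (hq : Tendsto (fun p => m (p + 1) / m p) atTop atTop) {s : ℝ} (hs : 0 < s) :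
    ∃ P, IsMaxIndex m s P ∧ HasDerivWithinAt (associatedFunction m) (P / s) (Set.Ici s) s := by
  obtain ⟨P, hP, hPe⟩ := exists_eventually_isMaxIndex_right hm hq hs
  refine ⟨P, hP, hasDerivWithinAt_Ioi_iff_Ici.1 ?_⟩
  refine (hasDerivAt_logTerm hm hs P).hasDerivWithinAt.congr_of_eventuallyEq ?_
    (hP.associatedFunction_eq hs)
  filter_upwards [hPe, self_mem_nhdsWithin] with t ht ht0
  exact ht.associatedFunction_eq (hs.trans ht0)

lemma finite_jumpSet_inter_Ioc (hm : ∀ p, 0 < m p)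
    (hq : Tendsto (fun p => m (p + 1) / m p) atTop atTop) (c b : ℝ) :
    (jumpSet m ∩ Set.Ioc c b).Finite := by
  obtain ⟨N, hN⟩ := bddAbove_isMaxIndex hm hq b
  refine Set.Finite.subset (s := ⋃ p ∈ Finset.range (N + 1), ⋃ q ∈ Finset.range (N + 1),
    {t | 0 < t ∧ p ≠ q ∧ IsMaxIndex m t p ∧ IsMaxIndex m t q}) ?_ ?_
  · refine Set.Finite.biUnion (Finset.finite_toSet _) fun p _ =>
      Set.Finite.biUnion (Finset.finite_toSet _) fun q _ => Set.Subsingleton.finite ?_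
    -- A fixed pair of distinct indices can tie at one point only, their difference being injective
    -- in `log t`.
    rintro s ⟨hs, hne, hsp, hsq⟩ t ⟨ht, -, htp, htq⟩
    have h1 := hsp.logTerm_sub_eq hm hs ht hsq
    have h2 := le_antisymm (htp q) (htq p)
    have hne' : (p : ℝ) - q ≠ 0 := sub_ne_zero.2 (by exact_mod_cast hne)
    have h3 : Real.log t - Real.log s = 0 := by
      have : ((p : ℝ) - q) * (Real.log t - Real.log s) = 0 := by linarith
      exact (mul_eq_zero.1 this).resolve_left hne'
    exact Real.log_injOn_pos hs ht (by linarith)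
  · rintro t ⟨⟨ht, p, q, hne, hp, hq'⟩, -, htb⟩
    simp only [Set.mem_iUnion, Finset.mem_range, Nat.lt_succ_iff]
    exact ⟨p, hN t ht htb p hp, q, hN t ht htb q hq', ht, hne, hp, hq'⟩

end General

/-! ### Asymptotics when the quotients are `p + 1 + O(1)` -/

section Asymptotics

variable {m : ℕ → ℝ} {K : ℝ}

lemma tendsto_quotient_atTop (hK : ∀ p : ℕ, |m (p + 1) / m p - (p + 1)| ≤ K) :
    Tendsto (fun p => m (p + 1) / m p) atTop atTop := by
  refine tendsto_atTop_mono (f := fun p : ℕ => (p : ℝ) + (1 - K)) (fun p => ?_)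
    (tendsto_atTop_add_const_right _ _ tendsto_natCast_atTop_atTop)
  linarith [(abs_le.1 (hK p)).1]

lemma IsMaxIndex.abs_sub_le (hm : ∀ p, 0 < m p)
    (hK : ∀ p : ℕ, |m (p + 1) / m p - (p + 1)| ≤ K) {t : ℝ} (ht : 0 < t) {p : ℕ}
    (hp : IsMaxIndex m t p) : |(p : ℝ) - t| ≤ K + 1 := by
  have hK0 : 0 ≤ K := (abs_nonneg _).trans (hK 0)
  have h1 := (logTerm_succ_le_iff hm ht p).1 (hp (p + 1))
  have h2 := (abs_le.1 (hK p)).2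
  refine abs_le.2 ⟨by linarith, ?_⟩
  cases p with
  -- Index `0` has no left neighbour; here `t > 0` and `K ≥ 0` suffice.
  | zero => push_cast; linarith
  | succ p =>
    have h3 := not_lt.1 ((logTerm_succ_lt_iff hm ht p).not.1 (not_lt.2 (hp p)))
    have h4 := (abs_le.1 (hK p)).1
    push_cast
    linarith

/-- The right derivative `P / x` differs from `1` by at most `(K + 1) / x`; the bound is the
integral of this over `[1, t]`. -/
lemma abs_associatedFunction_sub_le (hm : ∀ p, 0 < m p)
    (hK : ∀ p : ℕ, |m (p + 1) / m p - (p + 1)| ≤ K) {t : ℝ} (ht : 1 ≤ t) :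
    |associatedFunction m t - associatedFunction m 1 - (t - 1)| ≤ (K + 1) * Real.log t := by
  have hq := tendsto_quotient_atTop hK
  have hpos : ∀ x ∈ Set.Icc 1 t, (0 : ℝ) < x := fun x hx => zero_lt_one.trans_le hx.1
  have hpos' : ∀ x ∈ Set.Ico 1 t, (0 : ℝ) < x := fun x hx => zero_lt_one.trans_le hx.1
  have hcont : ContinuousOn (associatedFunction m) (Set.Icc 1 t) := fun x hx =>
    (continuousAt_associatedFunction hm hq (hpos x hx)).continuousWithinAt
  have hder : ∀ x ∈ Set.Ico 1 t, ∃ P, IsMaxIndex m x P ∧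
      HasDerivWithinAt (associatedFunction m) (P / x) (Set.Ici x) x := fun x hx =>
    hasDerivWithinAt_associatedFunction hm hq (hpos' x hx)
  choose! P hP hPd using hder
  -- The barrier with `ε = 1` bounds `M` from above; with `ε = -1` it bounds `-M`.
  have hB : ∀ ε : ℝ, ∀ x, 0 < x →
      HasDerivAt (fun x => ε * (associatedFunction m 1 + (x - 1)) + (K + 1) * Real.log x)
        (ε + (K + 1) / x) x := by
    intro ε x hx
    have h1 := ((((hasDerivAt_id x).sub_const 1).const_add (associatedFunction m 1)).const_mul
      ε).add ((Real.hasDerivAt_log hx.ne').const_mul (K + 1))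
    rw [mul_one, ← div_eq_mul_inv] at h1
    exact h1
  have hBc : ∀ ε : ℝ, ContinuousOn
      (fun x => ε * (associatedFunction m 1 + (x - 1)) + (K + 1) * Real.log x) (Set.Icc 1 t) :=
    fun ε x hx => (hB ε x (hpos x hx)).continuousAt.continuousWithinAt
  have upper := image_le_of_deriv_right_le_deriv_boundary hcont hPd (by simp) (hBc 1)
    (fun x hx => (hB 1 x (hpos' x hx)).hasDerivWithinAt)
    (fun x hx => by
      have h0 := hpos' x hx
      have h1 := (abs_le.1 ((hP x hx).abs_sub_le hm hK h0)).2
      rw [one_add_div h0.ne']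
      gcongr
      linarith) (Set.right_mem_Icc.2 ht)
  have lower := image_le_of_deriv_right_le_deriv_boundary hcont.neg
    (fun x hx => (hPd x hx).neg) (by simp) (hBc (-1))
    (fun x hx => (hB (-1) x (hpos' x hx)).hasDerivWithinAt)
    (fun x hx => by
      have h0 := hpos' x hx
      have h1 := (abs_le.1 ((hP x hx).abs_sub_le hm hK h0)).1
      have h2 : -1 + (K + 1) / x = (-x + (K + 1)) / x := by field_simp
      rw [h2, ← neg_div]
      gcongr
      linarith) (Set.right_mem_Icc.2 ht)
  simp only [Pi.neg_apply] at lower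
  exact abs_le.2 ⟨by linarith, by linarith⟩

lemma tendsto_associatedFunction_div (hm : ∀ p, 0 < m p)
    (hK : ∀ p : ℕ, |m (p + 1) / m p - (p + 1)| ≤ K) :
    Tendsto (fun t => associatedFunction m t / t) atTop (𝓝 1) := by
  have hlog : Tendsto (fun t : ℝ => (K + 1) * (Real.log t / t)) atTop (𝓝 0) := by
    simpa using (Real.isLittleO_log_id_atTop.tendsto_div_nhds_zero).const_mul (K + 1)
  have h1 : Tendsto (fun t => (associatedFunction m t - associatedFunction m 1 - (t - 1)) / t)
      atTop (𝓝 0) := by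
    refine squeeze_zero_norm' ?_ hlog
    filter_upwards [eventually_ge_atTop 1] with t ht
    have h0 : 0 < t := zero_lt_one.trans_le ht
    rw [norm_div, Real.norm_eq_abs, Real.norm_eq_abs, abs_of_pos h0, ← mul_div_assoc]
    gcongr
    exact abs_associatedFunction_sub_le hm hK ht
  have h2 : Tendsto (fun t : ℝ => (associatedFunction m 1 - 1) / t) atTop (𝓝 0) :=
    tendsto_const_nhds.div_atTop tendsto_id
  have h3 := (h1.add h2).const_add 1
  rw [add_zero, add_zero] at h3
  refine h3.congr' ?_
  filter_upwards [eventually_gt_atTop 0] with t ht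
  field_simp
  ring

lemma tendsto_associatedFunction_atTop (hm : ∀ p, 0 < m p)
    (hK : ∀ p : ℕ, |m (p + 1) / m p - (p + 1)| ≤ K) :
    Tendsto (associatedFunction m) atTop atTop := by
  refine ((tendsto_associatedFunction_div hm hK).pos_mul_atTop one_pos tendsto_id).congr' ?_
  filter_upwards [eventually_gt_atTop 0] with t ht
  exact div_mul_cancel₀ _ ht.ne'

lemma tendsto_proximateOrderCandidate (hm : ∀ p, 0 < m p)
    (hK : ∀ p : ℕ, |m (p + 1) / m p - (p + 1)| ≤ K) :
    Tendsto (proximateOrderCandidate m) atTop (𝓝 1) := by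
  have h1 : Tendsto (fun t => Real.log (associatedFunction m t / t)) atTop (𝓝 0) := by
    simpa using (tendsto_associatedFunction_div hm hK).log one_ne_zero
  have h2 := (h1.div_atTop Real.tendsto_log_atTop).const_add 1
  rw [add_zero] at h2
  refine h2.congr' ?_
  filter_upwards [eventually_gt_atTop 1,
    (tendsto_associatedFunction_atTop hm hK).eventually_gt_atTop 0] with t ht hM
  have := (Real.log_pos ht).ne'
  rw [proximateOrderCandidate, Real.log_div hM.ne' (zero_lt_one.trans ht).ne']
  field_simp
  ring

lemma tendsto_maxIndex_div_associatedFunction (hm : ∀ p, 0 < m p)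
    (hK : ∀ p : ℕ, |m (p + 1) / m p - (p + 1)| ≤ K) {P : ℝ → ℕ}
    (hP : ∀ t, 0 < t → IsMaxIndex m t (P t)) :
    Tendsto (fun t => (P t : ℝ) / associatedFunction m t) atTop (𝓝 1) := by
  have h1 : Tendsto (fun t => ((P t : ℝ) - t) / t) atTop (𝓝 0) := by
    refine squeeze_zero_norm' (a := fun t => (K + 1) / t) ?_
      (tendsto_const_nhds.div_atTop tendsto_id)
    filter_upwards [eventually_gt_atTop 0] with t ht
    rw [norm_div, Real.norm_eq_abs, Real.norm_eq_abs, abs_of_pos ht]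
    gcongr
    exact (hP t ht).abs_sub_le hm hK ht
  have h2 := (h1.const_add 1).div (tendsto_associatedFunction_div hm hK) one_ne_zero
  rw [add_zero, div_one] at h2
  refine h2.congr' ?_
  filter_upwards [eventually_gt_atTop 0,
    (tendsto_associatedFunction_atTop hm hK).eventually_gt_atTop 0] with t ht hM
  simp only [Pi.div_apply]
  field_simp
  ring

end Asymptotics

/-! ### Regularity of `d` and the derivative condition -/

section ProximateOrder

variable {m : ℕ → ℝ}

lemma hasDerivAt_log_logTerm_div_log (hm : ∀ p, 0 < m p) {p : ℕ} {t : ℝ} (ht : 1 < t)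
    (hp : 0 < logTerm m p t) :
    HasDerivAt (fun t => Real.log (logTerm m p t) / Real.log t)
      ((p / t / logTerm m p t * Real.log t - Real.log (logTerm m p t) * t⁻¹) / Real.log t ^ 2)
      t := by
  have h0 : 0 < t := zero_lt_one.trans ht
  exact ((hasDerivAt_logTerm hm h0 p).log hp.ne').div (Real.hasDerivAt_log h0.ne')
    (Real.log_pos ht).ne'

lemma continuousAt_deriv_log_logTerm_div_log (hm : ∀ p, 0 < m p) {p : ℕ} {t : ℝ} (ht : 1 < t)
    (hp : 0 < logTerm m p t) :
    ContinuousAt (deriv fun t => Real.log (logTerm m p t) / Real.log t) t := by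
  have h0 : 0 < t := zero_lt_one.trans ht
  have hc := (hasDerivAt_logTerm hm h0 p).continuousAt
  have hl := Real.continuousAt_log h0.ne'
  have hev : (deriv fun t => Real.log (logTerm m p t) / Real.log t) =ᶠ[𝓝 t] fun t =>
      (p / t / logTerm m p t * Real.log t - Real.log (logTerm m p t) * t⁻¹) / Real.log t ^ 2 := by
    filter_upwards [lt_mem_nhds ht, hc.eventually_const_lt hp] with x hx hx'
    exact (hasDerivAt_log_logTerm_div_log hm hx hx').deriv
  refine ContinuousAt.congr ?_ hev.symm
  exact ((((continuousAt_const.div continuousAt_id h0.ne').div hc hp.ne').mul hl).sub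
    ((hc.log hp.ne').mul (continuousAt_id.inv₀ h0.ne'))).div (hl.pow 2)
      (pow_ne_zero 2 (Real.log_pos ht).ne')

lemma proximateOrderCandidate_eq {t : ℝ} (ht : 0 < t) {p : ℕ} (hp : IsMaxIndex m t p) :
    proximateOrderCandidate m t = Real.log (logTerm m p t) / Real.log t := by
  rw [proximateOrderCandidate, hp.associatedFunction_eq ht]

lemma tendsto_deriv_proximateOrderCandidate (hm : ∀ p, 0 < m p) {s : ℝ} (hs : 1 < s) {p : ℕ}
    (hp : 0 < logTerm m p s) {A : Set ℝ} (hA : IsOpen A)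
    (hev : ∀ᶠ t in 𝓝[A] s, IsMaxIndex m t p) :
    Tendsto (deriv (proximateOrderCandidate m)) (𝓝[A] s)
      (𝓝 (deriv (fun t => Real.log (logTerm m p t) / Real.log t) s)) := by
  refine ((continuousAt_deriv_log_logTerm_div_log hm hs hp).tendsto.mono_left
    nhdsWithin_le_nhds).congr' ?_
  have hpos : ∀ᶠ t in 𝓝[A] s, (0 : ℝ) < t :=
    nhdsWithin_le_nhds (lt_mem_nhds (zero_lt_one.trans hs))
  -- As `A` is open, maximality of `p` holds on a full neighbourhood of each nearby `t ∈ A`, so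
  -- derivatives can be compared there.
  have h := eventually_eventually_nhdsWithin.2 (hev.and hpos)
  filter_upwards [h, self_mem_nhdsWithin] with t ht htA
  rw [hA.nhdsWithin_eq htA] at ht
  refine (EventuallyEq.deriv_eq ?_).symm
  filter_upwards [ht] with x hx
  exact proximateOrderCandidate_eq hx.2 hx.1

/-- If the quotients of consecutive terms of `m` are within bounded distance of `p + 1`, then
`log M(t) / log t` is a nonzero proximate order near infinity. -/
theorem exists_isNonzeroProximateOrder (hm : ∀ p, 0 < m p) {K : ℝ}
    (hK : ∀ p : ℕ, |m (p + 1) / m p - (p + 1)| ≤ K) :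
    ∃ c : ℝ, 1 ≤ c ∧ (∀ t : ℝ, c < t → 0 < associatedFunction m t) ∧
      IsNonzeroProximateOrder c (proximateOrderCandidate m) := by
  have hq := tendsto_quotient_atTop hK
  -- Asking for `M ≥ 1`, not just `M > 0`, makes `log M`, and so `d`, nonnegative.
  obtain ⟨c, hc⟩ := eventually_atTop.1 (((tendsto_associatedFunction_atTop hm
    hK).eventually_ge_atTop 1).and (eventually_ge_atTop 1))
  have hc1 : 1 ≤ c := (hc c le_rfl).2
  have hM : ∀ t, c < t → 1 ≤ associatedFunction m t := fun t ht => (hc t ht.le).1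
  have hone : ∀ t, c < t → 1 < t := fun t ht => hc1.trans_lt ht
  have hzero : ∀ t, c < t → 0 < t := fun t ht => zero_lt_one.trans (hone t ht)
  have hL : ∀ t, c < t → ∀ p, IsMaxIndex m t p → 0 < logTerm m p t := fun t ht p hp => by
    rw [← hp.associatedFunction_eq (hzero t ht)]
    exact one_pos.trans_le (hM t ht)
  have hloc : ∀ t, c < t → t ∉ jumpSet m → ∀ p, IsMaxIndex m t p →
      proximateOrderCandidate m =ᶠ[𝓝 t] fun t => Real.log (logTerm m p t) / Real.log t := by
    intro t ht htS p hp
    filter_upwards [eventually_isMaxIndex_of_notMem_jumpSet hm hq (hzero t ht) htS hp,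
      lt_mem_nhds (hzero t ht)] with x hx hx0
    exact proximateOrderCandidate_eq hx0 hx
  refine ⟨c, hc1, fun t ht => one_pos.trans_le (hM t ht), ?_, ?_,
    ⟨1, one_pos, tendsto_proximateOrderCandidate hm hK⟩, jumpSet m,
    finite_jumpSet_inter_Ioc hm hq c, ?_, ?_, ?_, ?_⟩
  · intro t ht
    exact (((continuousAt_associatedFunction hm hq (hzero t ht)).log
      (one_pos.trans_le (hM t ht)).ne').div (Real.continuousAt_log (hzero t ht).ne')
      (Real.log_pos (hone t ht)).ne').continuousWithinAt
  · exact fun t ht => div_nonneg (Real.log_nonneg (hM t ht)) (Real.log_pos (hone t ht)).le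
  · rintro t ⟨ht, htS⟩
    obtain ⟨p, hp⟩ := exists_isMaxIndex hm hq (hzero t ht)
    exact (hasDerivAt_log_logTerm_div_log hm (hone t ht)
      (hL t ht p hp)).differentiableAt.congr_of_eventuallyEq (hloc t ht htS p hp)
  · rintro t ⟨ht, htS⟩
    obtain ⟨p, hp⟩ := exists_isMaxIndex hm hq (hzero t ht)
    exact ((continuousAt_deriv_log_logTerm_div_log hm (hone t ht) (hL t ht p hp)).congr
      (hloc t ht htS p hp).deriv.symm).continuousWithinAt
  · rintro s ⟨-, hs⟩
    obtain ⟨P, hP, hPe⟩ := exists_eventually_isMaxIndex_right hm hq (hzero s hs)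
    obtain ⟨Q, hQ, hQe⟩ := exists_eventually_isMaxIndex_left hm hq (hzero s hs)
    exact ⟨⟨_, tendsto_deriv_proximateOrderCandidate hm (hone s hs) (hL s hs Q hQ) isOpen_Iio hQe⟩,
      ⟨_, tendsto_deriv_proximateOrderCandidate hm (hone s hs) (hL s hs P hP) isOpen_Ioi hPe⟩⟩
  · have hex : ∀ t : ℝ, 0 < t → ∃ p, IsMaxIndex m t p := fun t ht => exists_isMaxIndex hm hq ht
    choose! P hP using hex
    -- Off the ties `t d'(t) log t` equals `P t / M(t) - d(t)`, and both terms tend to `1`.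
    have hlim := (tendsto_maxIndex_div_associatedFunction hm hK hP).sub
      (tendsto_proximateOrderCandidate hm hK)
    rw [sub_self] at hlim
    refine (hlim.mono_left inf_le_left).congr' (eventually_inf_principal.2 ?_)
    filter_upwards [eventually_gt_atTop c] with t ht htS
    have hPt := hP t (hzero t ht)
    have hLt := hL t ht _ hPt
    rw [(hloc t ht htS _ hPt).deriv_eq,
      (hasDerivAt_log_logTerm_div_log hm (hone t ht) hLt).deriv,
      proximateOrderCandidate_eq (hzero t ht) hPt, hPt.associatedFunction_eq (hzero t ht)]
    have h1 := (Real.log_pos (hone t ht)).ne'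
    have h2 := (hzero t ht).ne'
    field_simp

end ProximateOrder

/-! ### Quotients of Dunkl factorials -/

section Dunkl

variable {α : ℝ}

lemma dunklFactorial_pos (hα : -1 < α) (p : ℕ) : 0 < dunklFactorial α p := by
  have h : ∀ k, 0 < (ascPochhammer ℝ k).eval (α + 1) := fun k =>
    ascPochhammer_pos k _ (by linarith)
  rw [dunklFactorial]
  split_ifs
  · have := h (p / 2)
    positivity
  · have := h (p / 2 + 1)
    positivity

/-- Passing from `2k` to `2k + 1` adds the Pochhammer factor `α + 1 + k`; passing from `2k + 1` to
`2k + 2` adds the factorial factor `k + 1`. Each comes with a factor `2`. -/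
lemma dunklFactorial_succ (α : ℝ) (p : ℕ) :
    dunklFactorial α (p + 1) =
      dunklFactorial α p * (p + 1 + if Even p then 2 * α + 1 else 0) := by
  rcases Nat.even_or_odd' p with ⟨k, rfl | rfl⟩
  · have h1 : (2 * k + 1) / 2 = k := by omega
    have h2 : 2 * k / 2 = k := by omega
    have h3 : ¬ Even (2 * k + 1) := by simp
    rw [dunklFactorial, dunklFactorial, if_neg h3, if_pos (even_two_mul k),
      if_pos (even_two_mul k), h1, h2, ascPochhammer_succ_eval]
    push_cast
    ring
  · have h1 : (2 * k + 1) / 2 = k := by omega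
    have h2 : (2 * k + 1 + 1) / 2 = k + 1 := by omega
    have h3 : ¬ Even (2 * k + 1) := by simp
    have h4 : Even (2 * k + 1 + 1) := ⟨k + 1, by ring⟩
    rw [dunklFactorial, dunklFactorial, if_pos h4, if_neg h3, if_neg h3, h1, h2,
      Nat.factorial_succ]
    push_cast
    ring

lemma abs_dunklFactorial_quotient_sub_le (hα : -1 < α) (p : ℕ) :
    |dunklFactorial α (p + 1) / dunklFactorial α p - (p + 1)| ≤ |2 * α + 1| := by
  rw [dunklFactorial_succ, mul_div_cancel_left₀ _ (dunklFactorial_pos hα p).ne',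
    add_sub_cancel_left]
  split_ifs <;> simp

end Dunkl

theorem mainTheorem4 (α : ℝ) (hα : -1 < α) :
    (∀ t : ℝ, 0 < t →
      BddAbove (Set.range fun p : ℕ => Real.log (t ^ p / dunklFactorial α p))) ∧
    ∃ c : ℝ, 1 ≤ c ∧
      (∀ t : ℝ, c < t → 0 < associatedFunction (dunklFactorial α) t) ∧
      IsNonzeroProximateOrder c (proximateOrderCandidate (dunklFactorial α)) := by
  have hm := dunklFactorial_pos hα
  have hK := abs_dunklFactorial_quotient_sub_le hα
  refine ⟨fun t ht => ?_, exists_isNonzeroProximateOrder hm hK⟩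
  obtain ⟨p, hp⟩ := exists_isMaxIndex hm (tendsto_quotient_atTop hK) ht
  exact hp.bddAbove
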